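/- **Conventions.** Let $n,r,p$ be natural numbers. A multiindex is a nonempty finite sequence $I=(i_1,\dots,i_k)$ with $i_j\in\{0,1,\dots,n\}$; its weight is $|I|=p_{i_1}+\dots+p_{i_k}$, where $p_0=2$ and $p_i=1$ for $i\ge 1$. For vector fields $X_0,\dots,X_n$ put $X_{[I]}=[X_{i_1},[X_{i_2},\dots[X_{i_{k-1}},X_{i_k}]\dots]]$ (and $X_{[(i)]}=X_i$). Let $A_{IJ}$ be the universal constants with $\xi_{[I]}=\sum_J A_{IJ}\,\xi_{j_1}\cdots\xi_{j_l}$ ($J=(j_1,\dots,j_l)$) for noncommuting variables $\xi_0,\dots,\xi_n$, where $\xi_{[I]}$ is the corresponding iterated commutator. The fields $X_0,\dots,X_n$ are *free up to weight $r$ at $\bar x$* if for all real constants $(a_I)_{|I|\le r}$, $\sum_{|I|\le r}a_I (X_{[I]})_{\bar x}=0$ implies $\sum_{|I|\le r}a_IA_{IJ}=0$ for all $J$. **Setting.** Let $\Omega\subseteq\mathbb R^p$ be open, $\bar x\in\Omega$, and let $X_0,\dots,X_n$ be $C^\infty$ vector fields on $\Omega$ that are free up to weight $r$ at $\bar x$.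 Let $B$ be a finite set of multiindices of weight $\le r$ such that $\{(X_{[I]})_{\bar x}\}_{I\in B}$ is a basis of $\mathbb R^p$. Let $u=(u_I)_{I\in B}$ be the canonical coordinates near $\bar x$, i.e. the smooth local coordinates whose inverse is $u\mapsto \exp\big(\sum_{I\in B}u_IX_{[I]}\big)(\bar x)$ for $u$ in an open neighbourhood of $0$; here $\exp(Z)(\bar x)=\varphi(1)$, where $\varphi:[0,1]\to\Omega$ solves $\varphi'=Z_\varphi$, $\varphi(0)=\bar x$. A function $f$ of $u$ that is $C^\infty$ near $0$ has *weight $\ge s$* if its Taylor expansion at $0$ contains no term $a\,u_{I_1}\cdots u_{I_k}$ with $a\ne0$ and $|I_1|+\dots+|I_k|<s$; a vector field $\sum_{I\in B}f_I\,\partial_{u_I}$ has weight $\ge s$ if $f_I$ has weight $\ge s+|I|$ for every $I\in B$. **Theorem.** Let $Y_0,\dots,Y_n$ be any $C^\infty$ vector fields in the variables $u$, defined on an open neighbourhood of $u=0$, such that on this neighbourhood $$\sum_{I\in B}u_I\,\frac{\partial}{\partial u_I}=\sum_{I\in B}u_I\,Y_{[I]} .$$ Then, with $X_{[I]}$ expressed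 in the canonical coordinates $u$, the vector field $X_{[I]}-Y_{[I]}$ has weight $\ge 1-|I|$ for every multiindex $I$. -/

import Mathlib

open scoped ContDiff

noncomputable section

namespace WeightedFields

/-- The weight `p_i` of the index `i ∈ {0, …, n}`: `p_0 = 2` and `p_i = 1` for `i ≥ 1`. -/
def indexWeight {n : ℕ} (i : Fin (n + 1)) : ℕ := if i = 0 then 2 else 1

/-- The weight `|I| = p_{i₁} + ⋯ + p_{i_k}` of `I = (i₁, …, i_k)`.  A multiindex is a nonempty list
with entries in `{0, …, n}`. -/
def weight {n : ℕ} (I : List (Fin (n + 1))) : ℕ := (I.map indexWeight).sum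

/-- The iterated bracket `x_[I] = [x_{i₁}, [x_{i₂}, … [x_{i_{k-1}}, x_{i_k}] … ]]` for a bracket
operation `br`.  The empty list is not a multiindex; its value `0` is a convention. -/
def nested {L : Type*} [Zero L] (br : L → L → L) {n : ℕ} (x : Fin (n + 1) → L) :
    List (Fin (n + 1)) → L
  | [] => 0
  | [i] => x i
  | i :: j :: I => br (x i) (nested br x (j :: I))

/-- The vector field `X_[I]`; a vector field on (part of) `E` is a map `E → E`. -/
def bracket {E : Type*} [NormedAddCommGroup E] [NormedSpace ℝ E] {n : ℕ}
    (X : Fin (n + 1) → E → E) (I : List (Fin (n + 1))) : E → E :=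
  nested (VectorField.lieBracket ℝ) X I

/-- The universal constants `A_{IJ}` in `X_[I] = ∑_J A_{IJ} X_J`: the coefficient of the monomial
`ξ_J = ξ_{j₁} ⋯ ξ_{j_k}` in the iterated commutator `ξ_[I]` of the noncommuting variables
`ξ_0, …, ξ_n`. -/
def universalCoeff {n : ℕ} (I J : List (Fin (n + 1))) : ℝ :=
  (FreeAlgebra.equivMonoidAlgebraFreeMonoid
    (nested (fun a b => a * b - b * a) (FreeAlgebra.ι ℝ : Fin (n + 1) → _) I)).coeff
    (FreeMonoid.ofList J)

/-- The vector fields `X_0, …, X_n` are free up to weight `s` at `x`: every linear relation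
`∑_{|I| ≤ s} a_I (X_[I])_x = 0` implies `∑_{|I| ≤ s} a_I A_{IJ} = 0` for all `J`. -/
def IsFreeUpToWeightAt {E : Type*} [NormedAddCommGroup E] [NormedSpace ℝ E] {n : ℕ}
    (X : Fin (n + 1) → E → E) (s : ℕ) (x : E) : Prop :=
  ∀ a : List (Fin (n + 1)) →₀ ℝ, (∀ I ∈ a.support, I ≠ [] ∧ weight I ≤ s) →
    (a.sum fun I c => c • bracket X I x) = 0 →
    ∀ J : List (Fin (n + 1)), (a.sum fun I c => c * universalCoeff I J) = 0

/-- `y = exp(Z)(x)` inside `Ω`: the solution of `φ' = Z_φ`, `φ(0) = x`, exists in `Ω` on `[0, 1]`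
and `φ(1) = y`. -/
def IsExp {E : Type*} [NormedAddCommGroup E] [NormedSpace ℝ E]
    (Ω : Set E) (Z : E → E) (x y : E) : Prop :=
  ∃ φ : ℝ → E, φ 0 = x ∧ φ 1 = y ∧ (∀ τ ∈ Set.Icc (0 : ℝ) 1, φ τ ∈ Ω) ∧
    IsIntegralCurveOn φ (fun _ => Z) (Set.Icc 0 1)

/-- `e` is the system of canonical coordinates `(u_I)_{I ∈ B}` near `xbar`: a smooth local
coordinate system (a diffeomorphism from an open subset of `Ω` onto an open neighbourhood of `0`)
whose inverse is the map `u ↦ exp(∑_{I ∈ B} u_I X_[I])(xbar)`. -/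
structure IsCanonicalCoordinates {E : Type*} [NormedAddCommGroup E] [NormedSpace ℝ E] {n : ℕ}
    (Ω : Set E) (X : Fin (n + 1) → E → E) (B : Finset (List (Fin (n + 1)))) (xbar : E)
    (e : OpenPartialHomeomorph E (B → ℝ)) : Prop where
  source_subset : e.source ⊆ Ω
  zero_mem : (0 : B → ℝ) ∈ e.target
  smooth : ContDiffOn ℝ ∞ e e.source
  smooth_symm : ContDiffOn ℝ ∞ e.symm e.target
  eq_exp : ∀ u ∈ e.target,
    IsExp Ω (fun x => ∑ I : B, u I • bracket X (I : List (Fin (n + 1))) x) xbar (e.symm u)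

/-- A function `f` of `u = (u_I)_{I ∈ B}` that is smooth near `0` has weight `≥ s`: the Taylor
coefficients at `0` of all monomials `u_{I₁} ⋯ u_{I_k}` with `|I₁| + ⋯ + |I_k| < s` vanish, i.e.
`∂_{I₁} ⋯ ∂_{I_k} f (0) = 0`. -/
def FunWeightGE {n : ℕ} {B : Finset (List (Fin (n + 1)))} (f : (B → ℝ) → ℝ) (s : ℤ) : Prop :=
  ContDiffAt ℝ ∞ f 0 ∧
    ∀ (k : ℕ) (I : Fin k → B), ((∑ j, weight (I j : List (Fin (n + 1))) : ℕ) : ℤ) < s →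
      iteratedFDeriv ℝ k f 0 (fun j => Pi.single (I j) (1 : ℝ)) = 0

/-- A vector field `Z = ∑_{I ∈ B} f_I ∂/∂u_I` has weight `≥ s`: each `f_I` has weight
`≥ s + |I|`. -/
def FieldWeightGE {n : ℕ} {B : Finset (List (Fin (n + 1)))} (Z : (B → ℝ) → (B → ℝ)) (s : ℤ) :
    Prop :=
  ∀ I : B, FunWeightGE (fun u => Z u I) (s + weight (I : List (Fin (n + 1))))

end WeightedFields

end

/-! Let `E = ∑ u_I ∂_I` be the Euler field, and let `F_I` stand for either `X_[I]` (in the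
coordinates `u`) or `Y_[I]`, with `I ∈ B`. Canonical coordinates send rays through `0` to integral
curves of `∑ u_I X_[I]`, so both systems satisfy `E = ∑ u_I F_I`. Freeness turns relations among the
`X_[I]` at `xbar` into identities between iterated commutators in the free algebra. These hold for
every system of fields, so both families have the same constant structure coefficients for brackets
of weight `≤ r`, and these coefficients respect weight.

Write `F_j = ∂_j + ∑_k f_jk ∂_k`. Differentiating the Euler identity along `F_j` gives `(E + 1) f_jk
= ∑_i u_i [F_i, F_j]_k - ∑_i f_ji f_ik` (`IsEulerFrame.euler_frameError`). The operator `E + 1`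
multiplies the Taylor terms of degree `d` by `d + 1`, so it loses no information. On the right,
`u_i` and all the `f` vanish at `0`, so the right side to order `n + 1` depends only on the `f` to
order `n`. Induction on the order gives first that `f_jk` has weight `≥ w_k - w_j`
(`IsEulerFrame.weight_frameError`), and then, on subtracting the equations of the two systems, that
the difference has weight one more (`IsEulerFrame.weight_sub`). Brackets of weight `> r` do no harm:
since every `w_k ≤ r`, the bounds required of them are nonpositive and hence void.

A general `X_[I] - Y_[I]` with `|I| ≤ r` is a constant combination of those with index in `B` of the
same weight; for `|I| > r` the claim is again void. -/

noncomputable section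

namespace WeightedFields

/-! ### Calculus of weights, by induction on the order of differentiation. -/

section Weights

set_option linter.unusedSectionVars false

variable {ι : Type*} [Fintype ι] [DecidableEq ι]

/-- The partial derivative in the direction of the `i`-th coordinate. -/
def partialDeriv (i : ι) (f : (ι → ℝ) → ℝ) : (ι → ℝ) → ℝ :=
  fun u => fderiv ℝ f u (Pi.single i 1)

/-- All partial derivatives of `f` at `0` of order `≤ k` and of weight `< s` vanish, where the
coordinate `u i` has weight `w i`. -/
def WeightGEUpTo (w : ι → ℕ) : ℕ → ℤ → ((ι → ℝ) → ℝ) → Prop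
  | 0, s, f => 0 < s → f 0 = 0
  | k + 1, s, f => (0 < s → f 0 = 0) ∧ ∀ i, WeightGEUpTo w k (s - w i) (partialDeriv i f)

variable {w : ι → ℕ} {U : Set (ι → ℝ)} {f g : (ι → ℝ) → ℝ} {k : ℕ} {s t : ℤ}

lemma differentiableAt_of_contDiffOn {E F : Type*} [NormedAddCommGroup E] [NormedSpace ℝ E]
    [NormedAddCommGroup F] [NormedSpace ℝ F] {f : E → F} {U : Set E}
    (hU : IsOpen U) (hf : ContDiffOn ℝ ∞ f U) {u : E} (hu : u ∈ U) : DifferentiableAt ℝ f u :=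
  (hf.contDiffAt (hU.mem_nhds hu)).differentiableAt (by simp)

lemma contDiffOn_fderiv_apply {E F : Type*} [NormedAddCommGroup E] [NormedSpace ℝ E]
    [NormedAddCommGroup F] [NormedSpace ℝ F] {f : E → F} {Z : E → E} {U : Set E} (hU : IsOpen U)
    (hf : ContDiffOn ℝ ∞ f U) (hZ : ContDiffOn ℝ ∞ Z U) :
    ContDiffOn ℝ ∞ (fun u => fderiv ℝ f u (Z u)) U :=
  (hf.fderiv_of_isOpen hU (by simp)).clm_apply hZ

lemma contDiffOn_partialDeriv (hU : IsOpen U) (hf : ContDiffOn ℝ ∞ f U) (i : ι) :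
    ContDiffOn ℝ ∞ (partialDeriv i f) U :=
  contDiffOn_fderiv_apply hU hf contDiffOn_const

lemma partialDeriv_eqOn (hU : IsOpen U) (h : Set.EqOn f g U) (i : ι) :
    Set.EqOn (partialDeriv i f) (partialDeriv i g) U := fun u hu => by
  simp only [partialDeriv, (h.eventuallyEq_of_mem (hU.mem_nhds hu)).fderiv_eq]

lemma WeightGEUpTo.congr (hU : IsOpen U) (h0 : (0 : ι → ℝ) ∈ U) (hfg : Set.EqOn f g U)
    (hf : WeightGEUpTo w k s f) : WeightGEUpTo w k s g := by
  induction k generalizing s f g with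
  | zero => exact fun hs => (hfg h0).symm.trans (hf hs)
  | succ k ih =>
    exact ⟨fun hs => (hfg h0).symm.trans (hf.1 hs),
      fun i => ih (partialDeriv_eqOn hU hfg i) (hf.2 i)⟩

lemma WeightGEUpTo.apply_zero (hf : WeightGEUpTo w k s f) (hs : 0 < s) : f 0 = 0 := by
  cases k with
  | zero => exact hf hs
  | succ k => exact hf.1 hs

lemma WeightGEUpTo.of_succ (hf : WeightGEUpTo w (k + 1) s f) : WeightGEUpTo w k s f := by
  induction k generalizing s f with
  | zero => exact hf.1
  | succ k ih => exact ⟨hf.1, fun i => ih (hf.2 i)⟩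

lemma WeightGEUpTo.mono (hf : WeightGEUpTo w k s f) (hts : t ≤ s) : WeightGEUpTo w k t f := by
  induction k generalizing s t f with
  | zero => exact fun ht => hf (ht.trans_le hts)
  | succ k ih => exact ⟨fun ht => hf.1 (ht.trans_le hts), fun i => ih (hf.2 i) (by omega)⟩

lemma weightGEUpTo_of_nonpos (f : (ι → ℝ) → ℝ) (hs : s ≤ 0) : WeightGEUpTo w k s f := by
  induction k generalizing s f with
  | zero => exact fun h => absurd h (by omega)
  | succ k ih => exact ⟨fun h => absurd h (by omega), fun i => ih _ (by omega)⟩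

lemma weightGEUpTo_const {c : ℝ} (hc : 0 < s → c = 0) :
    WeightGEUpTo w k s (fun _ : ι → ℝ => c) := by
  have key : ∀ (k : ℕ) (s : ℤ), WeightGEUpTo w k s (fun _ : ι → ℝ => (0 : ℝ)) := by
    intro k
    induction k with
    | zero => exact fun s _ => rfl
    | succ k ih =>
      refine fun s => ⟨fun _ => rfl, fun i => ?_⟩
      have : partialDeriv i (fun _ : ι → ℝ => (0 : ℝ)) = fun _ => 0 := by
        ext u; simp [partialDeriv]
      rw [this]; exact ih _
  cases k with
  | zero => exact hc
  | succ k =>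
    refine ⟨hc, fun i => ?_⟩
    have : partialDeriv i (fun _ : ι → ℝ => c) = fun _ => 0 := by
      ext u; simp [partialDeriv]
    rw [this]; exact key _ _

lemma weightGEUpTo_coord (i : ι) : WeightGEUpTo w k (w i) (fun u : ι → ℝ => u i) := by
  cases k with
  | zero => exact fun _ => rfl
  | succ k =>
    refine ⟨fun _ => rfl, fun j => ?_⟩
    have : partialDeriv j (fun u : ι → ℝ => u i) = fun _ => (Pi.single j (1 : ℝ) : ι → ℝ) i := by
      ext u
      have := (ContinuousLinearMap.proj (R := ℝ) (φ := fun _ : ι => ℝ) i).hasFDerivAt (x := u)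
      rw [partialDeriv, show (fun u : ι → ℝ => u i) =
        ⇑(ContinuousLinearMap.proj (R := ℝ) (φ := fun _ : ι => ℝ) i) from rfl, this.fderiv]
      rfl
    rw [this]
    refine weightGEUpTo_const fun hpos => ?_
    by_cases hij : i = j
    · subst hij; omega
    · simp [hij]

lemma WeightGEUpTo.add (hU : IsOpen U) (h0 : (0 : ι → ℝ) ∈ U) (hfs : ContDiffOn ℝ ∞ f U)
    (hgs : ContDiffOn ℝ ∞ g U) (hf : WeightGEUpTo w k s f) (hg : WeightGEUpTo w k s g) :
    WeightGEUpTo w k s (fun u => f u + g u) := by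
  induction k generalizing s f g with
  | zero => exact fun hs => by simp [hf hs, hg hs]
  | succ k ih =>
    refine ⟨fun hs => by simp [hf.1 hs, hg.1 hs], fun i => ?_⟩
    refine (ih (contDiffOn_partialDeriv hU hfs i) (contDiffOn_partialDeriv hU hgs i)
      (hf.2 i) (hg.2 i)).congr hU h0 fun u hu => ?_
    simp only [partialDeriv]
    rw [fderiv_fun_add (differentiableAt_of_contDiffOn hU hfs hu)
      (differentiableAt_of_contDiffOn hU hgs hu)]
    rfl

lemma partialDeriv_mul (hU : IsOpen U) (hfs : ContDiffOn ℝ ∞ f U) (hgs : ContDiffOn ℝ ∞ g U)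
    (i : ι) : Set.EqOn (fun u => partialDeriv i f u * g u + f u * partialDeriv i g u)
      (partialDeriv i fun u => f u * g u) U := fun u hu => by
  simp only [partialDeriv]
  rw [fderiv_fun_mul (differentiableAt_of_contDiffOn hU hfs hu)
    (differentiableAt_of_contDiffOn hU hgs hu)]
  simp
  ring

/-- Leibniz's rule. Negative `s` or `t` are allowed: the value at `0` only needs that `0 < s + t`
forces `0 < s` or `0 < t`. -/
lemma WeightGEUpTo.mul (hU : IsOpen U) (h0 : (0 : ι → ℝ) ∈ U) (hfs : ContDiffOn ℝ ∞ f U)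
    (hgs : ContDiffOn ℝ ∞ g U) (hf : WeightGEUpTo w k s f) (hg : WeightGEUpTo w k t g) :
    WeightGEUpTo w k (s + t) (fun u => f u * g u) := by
  have hval : 0 < s + t → f 0 * g 0 = 0 := fun hst => by
    rcases (by omega : 0 < s ∨ 0 < t) with h | h
    · simp [hf.apply_zero h]
    · simp [hg.apply_zero h]
  induction k generalizing s t f g with
  | zero => exact hval
  | succ k ih =>
    refine ⟨hval, fun i => ?_⟩
    have hf' := contDiffOn_partialDeriv hU hfs i
    have hg' := contDiffOn_partialDeriv hU hgs i
    have aux : ∀ {a b : ℤ} {p q : (ι → ℝ) → ℝ}, WeightGEUpTo w k a p → WeightGEUpTo w k b q →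
        0 < a + b → p 0 * q 0 = 0 := fun {a b p q} hp hq hab => by
      rcases (by omega : 0 < a ∨ 0 < b) with h | h
      · simp [hp.apply_zero h]
      · simp [hq.apply_zero h]
    have h1 := ih hf' hgs (hf.2 i) hg.of_succ (aux (hf.2 i) hg.of_succ)
    have h2 := ih hfs hg' hf.of_succ (hg.2 i) (aux hf.of_succ (hg.2 i))
    exact ((h1.mono (by omega)).add hU h0 (hf'.mul hgs) (hfs.mul hg')
      (h2.mono (by omega))).congr hU h0 (partialDeriv_mul hU hfs hgs i)

lemma WeightGEUpTo.const_mul (hU : IsOpen U) (h0 : (0 : ι → ℝ) ∈ U) (hfs : ContDiffOn ℝ ∞ f U)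
    (hf : WeightGEUpTo w k s f) (c : ℝ) : WeightGEUpTo w k s (fun u => c * f u) := by
  have hc : WeightGEUpTo w k 0 (fun _ : ι → ℝ => c) := weightGEUpTo_of_nonpos _ le_rfl
  simpa using hc.mul hU h0 contDiffOn_const hfs hf

lemma WeightGEUpTo.sub (hU : IsOpen U) (h0 : (0 : ι → ℝ) ∈ U) (hfs : ContDiffOn ℝ ∞ f U)
    (hgs : ContDiffOn ℝ ∞ g U) (hf : WeightGEUpTo w k s f) (hg : WeightGEUpTo w k s g) :
    WeightGEUpTo w k s (fun u => f u - g u) :=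
  (hf.add hU h0 hfs (contDiffOn_const.mul hgs) (hg.const_mul hU h0 hgs (-1))).congr hU h0
    fun u _ => by ring

lemma WeightGEUpTo.sum (hU : IsOpen U) (h0 : (0 : ι → ℝ) ∈ U) {α : Type*} (S : Finset α)
    {F : α → (ι → ℝ) → ℝ} (hFs : ∀ a ∈ S, ContDiffOn ℝ ∞ (F a) U)
    (hF : ∀ a ∈ S, WeightGEUpTo w k s (F a)) : WeightGEUpTo w k s (fun u => ∑ a ∈ S, F a u) := by
  classical
  induction S using Finset.induction_on with
  | empty => simpa using weightGEUpTo_const fun _ => rfl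
  | insert a S ha ih =>
    simp only [Finset.sum_insert ha]
    exact (hF a (by simp)).add hU h0 (hFs a (by simp))
      (ContDiffOn.sum fun b hb => hFs b (by simp [hb]))
      (ih (fun b hb => hFs b (by simp [hb])) fun b hb => hF b (by simp [hb]))

/-- A factor vanishing at `0` gains one order for the other factor. -/
lemma WeightGEUpTo.mul_of_apply_zero (hU : IsOpen U) (h0 : (0 : ι → ℝ) ∈ U)
    (hfs : ContDiffOn ℝ ∞ f U) (hgs : ContDiffOn ℝ ∞ g U) (hf : WeightGEUpTo w k s f)
    (hg : WeightGEUpTo w (k + 1) t g) (hg0 : g 0 = 0) :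
    WeightGEUpTo w (k + 1) (s + t) (fun u => f u * g u) := by
  induction k generalizing s f with
  | zero =>
    refine ⟨fun _ => by simp [hg0], fun i => ?_⟩
    have hf' := contDiffOn_partialDeriv hU hfs i
    have hg' := contDiffOn_partialDeriv hU hgs i
    have h1 : WeightGEUpTo w 0 (s + t - w i) (fun u => partialDeriv i f u * g u) :=
      fun _ => by simp [hg0]
    have h2 := hf.mul hU h0 hfs hg' (hg.2 i)
    exact (h1.add hU h0 (hf'.mul hgs) (hfs.mul hg') (h2.mono (by omega))).congr hU h0
      (partialDeriv_mul hU hfs hgs i)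
  | succ k ih =>
    refine ⟨fun _ => by simp [hg0], fun i => ?_⟩
    have hf' := contDiffOn_partialDeriv hU hfs i
    have hg' := contDiffOn_partialDeriv hU hgs i
    -- In `∂ᵢf · g` the factor `g` still vanishes at `0`, so induction applies; in `f · ∂ᵢg` both
    -- factors are already known to order `k + 1` and no gain is needed.
    have h1 := ih hf' (hf.2 i) hg.of_succ
    have h2 := hf.mul hU h0 hfs hg' (hg.2 i)
    exact ((h1.mono (by omega)).add hU h0 (hf'.mul hgs) (hfs.mul hg') (h2.mono (by omega))).congr
      hU h0 (partialDeriv_mul hU hfs hgs i)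

/-- If both factors vanish at `0`, the product gains one order. -/
lemma WeightGEUpTo.mul_of_apply_zero_of_apply_zero (hU : IsOpen U) (h0 : (0 : ι → ℝ) ∈ U)
    (hfs : ContDiffOn ℝ ∞ f U) (hgs : ContDiffOn ℝ ∞ g U) (hf : WeightGEUpTo w k s f)
    (hg : WeightGEUpTo w k t g) (hf0 : f 0 = 0) (hg0 : g 0 = 0) :
    WeightGEUpTo w (k + 1) (s + t) (fun u => f u * g u) := by
  refine ⟨fun _ => by simp [hg0], fun i => ?_⟩
  have hf' := contDiffOn_partialDeriv hU hfs i
  have hg' := contDiffOn_partialDeriv hU hgs i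
  -- A derivative costs one order of one factor, and the vanishing of the other factor at `0`
  -- restores it.
  have h1 : WeightGEUpTo w k (s + t - w i) (fun u => partialDeriv i f u * g u) := by
    cases k with
    | zero => exact fun _ => by simp [hg0]
    | succ k =>
      exact ((hf.2 i).mul_of_apply_zero hU h0 hf' hgs hg hg0).mono (by omega)
  have h2 : WeightGEUpTo w k (s + t - w i) (fun u => f u * partialDeriv i g u) := by
    cases k with
    | zero => exact fun _ => by simp [hf0]
    | succ k =>
      refine (((hg.2 i).mul_of_apply_zero hU h0 hg' hfs hf hf0).mono (by omega)).congr hU h0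
        fun u _ => by ring
  exact (h1.add hU h0 (hf'.mul hgs) (hfs.mul hg') h2).congr hU h0 (partialDeriv_mul hU hfs hgs i)

/-- The commutation rule `∂ᵢ E = (E + 1) ∂ᵢ`, from the symmetry of the second derivative. The shift
`m ↦ m + 1` preserves positivity, which lets `WeightGEUpTo.of_euler` run by induction with `m`
varying. -/
lemma partialDeriv_euler (hU : IsOpen U) (hfs : ContDiffOn ℝ ∞ f U) (m : ℝ) (i : ι) :
    Set.EqOn (partialDeriv i fun u => fderiv ℝ f u u + m * f u)
      (fun u => fderiv ℝ (partialDeriv i f) u u + (m + 1) * partialDeriv i f u) U := fun u hu => by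
  have hfu := hfs.contDiffAt (hU.mem_nhds hu)
  have hd : DifferentiableAt ℝ f u := hfu.differentiableAt (by simp)
  have hd2 : DifferentiableAt ℝ (fderiv ℝ f) u :=
    (hfu.fderiv_right (m := ∞) (by simp)).differentiableAt (by simp)
  have hsymm : IsSymmSndFDerivAt ℝ f u := hfu.isSymmSndFDerivAt (by simpa using (WithTop.coe_le_coe.2 le_top : (2 : ℕ∞ω) ≤ ∞))
  have hp : fderiv ℝ (partialDeriv i f) u =
      fderiv ℝ (fun v => fderiv ℝ f v (Pi.single i (1 : ℝ) : ι → ℝ)) u := rfl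
  simp only [hp]
  simp only [partialDeriv]
  rw [fderiv_fun_add (hd2.clm_apply differentiableAt_fun_id) (hd.const_mul m),
    fderiv_clm_apply hd2 differentiableAt_fun_id, fderiv_const_mul hd m,
    fderiv_clm_apply hd2 (differentiableAt_const _)]
  simp
  rw [hsymm.eq]
  ring

/-- The operator `E + m`, with `E` the Euler field and `m > 0`, does not raise weights. -/
lemma WeightGEUpTo.of_euler (hU : IsOpen U) (h0 : (0 : ι → ℝ) ∈ U) (hfs : ContDiffOn ℝ ∞ f U)
    {m : ℝ} (hm : 0 < m) (h : WeightGEUpTo w k s (fun u => fderiv ℝ f u u + m * f u)) :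
    WeightGEUpTo w k s f := by
  have hval : ∀ {f : (ι → ℝ) → ℝ} {m : ℝ}, 0 < m → fderiv ℝ f 0 0 + m * f 0 = 0 → f 0 = 0 :=
    fun hm h => by simpa [hm.ne'] using h
  induction k generalizing s f m with
  | zero => exact fun hs => hval hm (h hs)
  | succ k ih =>
    exact ⟨fun hs => hval hm (h.1 hs), fun i => ih (contDiffOn_partialDeriv hU hfs i)
      (by linarith : 0 < m + 1) ((h.2 i).congr hU h0 (partialDeriv_euler hU hfs m i))⟩

/-- The passage from the recursive predicate to the Taylor condition of `FunWeightGE`. The innermost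
derivative, taken first in the recursion, is the last argument of `iteratedFDeriv`. -/
lemma WeightGEUpTo.iteratedFDeriv_eq_zero (hU : IsOpen U) (h0 : (0 : ι → ℝ) ∈ U)
    (hfs : ContDiffOn ℝ ∞ f U) (hf : WeightGEUpTo w k s f) (I : Fin k → ι)
    (hI : ((∑ j, w (I j) : ℕ) : ℤ) < s) :
    iteratedFDeriv ℝ k f 0 (fun j => Pi.single (I j) (1 : ℝ)) = 0 := by
  induction k generalizing s f with
  | zero => simpa using hf (by simpa using hI)
  | succ k ih =>
    have hfd : ContDiffAt ℝ ∞ (fderiv ℝ f) 0 :=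
      (hfs.contDiffAt (hU.mem_nhds h0)).fderiv_right (by simp)
    have key := ih (contDiffOn_partialDeriv hU hfs (I (Fin.last k))) (hf.2 (I (Fin.last k)))
      (fun j => I j.castSucc) (by rw [Fin.sum_univ_castSucc] at hI; push_cast at hI ⊢; omega)
    rw [iteratedFDeriv_succ_apply_right]
    rw [← key]
    have := ContinuousLinearMap.iteratedFDeriv_comp_left
      (ContinuousLinearMap.apply ℝ ℝ (Pi.single (I (Fin.last k)) (1 : ℝ) : ι → ℝ)) hfd
      (i := k) (by exact_mod_cast le_top)
    have h2 : partialDeriv (I (Fin.last k)) f =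
      (ContinuousLinearMap.apply ℝ ℝ (Pi.single (I (Fin.last k)) (1 : ℝ) : ι → ℝ)) ∘ fderiv ℝ f :=
      rfl
    rw [h2, this]
    rfl

end Weights

/-! ### Frames satisfying the Euler identity, and their comparison. -/

section EulerFrame

set_option linter.unusedSectionVars false

open VectorField

variable {ι : Type*} [Fintype ι] [DecidableEq ι]

/-- Smooth vector fields `F i` on `U` with `∑ u_i ∂_i = ∑ u_i F_i`, whose brackets of weight `≤ r`
are linear combinations of the `F i` with constant coefficients `a`. -/
structure IsEulerFrame (w : ι → ℕ) (r : ℕ) (U : Set (ι → ℝ)) (a : ι → ι → ι → ℝ)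
    (F : ι → (ι → ℝ) → (ι → ℝ)) : Prop where
  smooth : ∀ i, ContDiffOn ℝ ∞ (F i) U
  euler : ∀ u ∈ U, ∑ i, u i • F i u = u
  lieBracket_eq : ∀ i j, w i + w j ≤ r → ∀ u ∈ U,
    lieBracket ℝ (F i) (F j) u = ∑ l, a i j l • F l u

variable {w : ι → ℕ} {r : ℕ} {U : Set (ι → ℝ)} {a : ι → ι → ι → ℝ}
  {F G : ι → (ι → ℝ) → (ι → ℝ)}

/-- The coefficient of `F j - ∂_j` at `∂_k`. -/
def frameError (F : ι → (ι → ℝ) → (ι → ℝ)) (j k : ι) : (ι → ℝ) → ℝ :=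
  fun u => F j u k - (Pi.single j (1 : ℝ) : ι → ℝ) k

lemma contDiffOn_lieBracket {E : Type*} [NormedAddCommGroup E] [NormedSpace ℝ E] {U : Set E}
    {V W : E → E} (hU : IsOpen U) (hV : ContDiffOn ℝ ∞ V U) (hW : ContDiffOn ℝ ∞ W U) :
    ContDiffOn ℝ ∞ (lieBracket ℝ V W) U :=
  (contDiffOn_fderiv_apply hU hW hV).sub (contDiffOn_fderiv_apply hU hV hW)

lemma IsEulerFrame.contDiffOn_apply (hF : IsEulerFrame w r U a F) (j k : ι) :
    ContDiffOn ℝ ∞ (fun u => F j u k) U :=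
  contDiffOn_pi.1 (hF.smooth j) k

lemma IsEulerFrame.contDiffOn_frameError (hF : IsEulerFrame w r U a F) (j k : ι) :
    ContDiffOn ℝ ∞ (frameError F j k) U :=
  (hF.contDiffOn_apply j k).sub contDiffOn_const

lemma IsEulerFrame.contDiffOn_lieBracket_apply (hU : IsOpen U) (hF : IsEulerFrame w r U a F)
    (i j k : ι) : ContDiffOn ℝ ∞ (fun u => lieBracket ℝ (F i) (F j) u k) U :=
  contDiffOn_pi.1 (contDiffOn_lieBracket hU (hF.smooth i) (hF.smooth j)) k

lemma fderiv_pi_apply {Z : (ι → ℝ) → (ι → ℝ)} {u : ι → ℝ} (hZ : DifferentiableAt ℝ Z u)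
    (v : ι → ℝ) (k : ι) : fderiv ℝ Z u v k = fderiv ℝ (fun u => Z u k) u v := by
  rw [fderiv_pi fun k => (differentiableAt_pi.1 hZ k)]
  rfl

/-- The derivative of the Euler identity in the direction `v`. -/
lemma IsEulerFrame.fderiv_euler (hU : IsOpen U) (hF : IsEulerFrame w r U a F) {u : ι → ℝ}
    (hu : u ∈ U) (v : ι → ℝ) (k : ι) :
    ∑ i, (v i * F i u k + u i * fderiv ℝ (fun x => F i x k) u v) = v k := by
  have hd : ∀ i, DifferentiableAt ℝ (fun x => F i x k) u := fun i =>
    differentiableAt_of_contDiffOn hU (hF.contDiffOn_apply i k) hu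
  have hpr : ∀ i, HasFDerivAt (fun x : ι → ℝ => x i)
      (ContinuousLinearMap.proj (R := ℝ) (φ := fun _ : ι => ℝ) i) u := fun i =>
    (ContinuousLinearMap.proj (R := ℝ) (φ := fun _ : ι => ℝ) i).hasFDerivAt
  have h1 : HasFDerivAt (fun x : ι → ℝ => ∑ i, x i * F i x k) _ u :=
    HasFDerivAt.fun_sum fun i _ => (hpr i).mul (hd i).hasFDerivAt
  have h2 : (fun x : ι → ℝ => ∑ i, x i * F i x k) =ᶠ[nhds u] fun x => x k := by
    filter_upwards [hU.mem_nhds hu] with x hx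
    simpa using congrFun (hF.euler x hx) k
  have h3 := (h1.congr_of_eventuallyEq h2.symm).unique (hpr k)
  have h4 := congrArg (fun L : (ι → ℝ) →L[ℝ] ℝ => L v) h3
  simp only [sum_apply, add_apply, smul_apply,
    ContinuousLinearMap.proj_apply, smul_eq_mul] at h4
  rw [← h4]
  exact Finset.sum_congr rfl fun i _ => by ring

/-- At `u = 0` the terms with a factor `u_i` drop out of the differentiated Euler identity, leaving
`F j 0 = ∂_j`. -/
lemma IsEulerFrame.frameError_apply_zero (hU : IsOpen U) (h0 : (0 : ι → ℝ) ∈ U)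
    (hF : IsEulerFrame w r U a F) (j k : ι) : frameError F j k 0 = 0 := by
  have := hF.fderiv_euler hU h0 (Pi.single j 1) k
  simp [Pi.single_apply] at this
  simp [frameError, Pi.single_apply, this]

/-- The differential equation along the Euler field satisfied by the coefficients. -/
lemma IsEulerFrame.euler_frameError (hU : IsOpen U) (hF : IsEulerFrame w r U a F) {u : ι → ℝ}
    (hu : u ∈ U) (j k : ι) :
    fderiv ℝ (frameError F j k) u u + 1 * frameError F j k u =
      ∑ i, lieBracket ℝ (F i) (F j) u k * u i - ∑ i, frameError F j i u * frameError F i k u := by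
  have hd : ∀ i, DifferentiableAt ℝ (F i) u := fun i =>
    differentiableAt_of_contDiffOn hU (hF.smooth i) hu
  have h1 : fderiv ℝ (frameError F j k) u u = ∑ i, u i * fderiv ℝ (fun x => F j x k) u (F i u) := by
    have h2 : fderiv ℝ (frameError F j k) u = fderiv ℝ (fun x => F j x k) u :=
      fderiv_sub_const _
    rw [h2, ← congrArg (fderiv ℝ (fun x => F j x k) u) (hF.euler u hu)]
    simp only [map_sum, map_smul, smul_eq_mul]
  have h3 : ∀ i, lieBracket ℝ (F i) (F j) u k * u i =
      u i * fderiv ℝ (fun x => F j x k) u (F i u) - u i * fderiv ℝ (fun x => F i x k) u (F j u) := by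
    intro i
    simp only [lieBracket, Pi.sub_apply]
    rw [fderiv_pi_apply (hd j), fderiv_pi_apply (hd i)]
    ring
  -- The direction `v = F j u` evaluates `∑ u_i DF_i(F_j)`, the second half of the bracket sum, as
  -- `F_j - ∑ F_ji F_i`; this is the source of the quadratic term.
  have h4 := hF.fderiv_euler hU hu (F j u) k
  rw [Finset.sum_add_distrib] at h4
  have h5 : ∑ i, frameError F j i u * frameError F i k u =
      ∑ i, F j u i * F i u k - F j u k - frameError F j k u := by
    have : ∀ i, frameError F j i u * frameError F i k u = F j u i * F i u k
        - F j u i * (Pi.single i (1 : ℝ) : ι → ℝ) k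
        - (Pi.single j (1 : ℝ) : ι → ℝ) i * frameError F i k u := fun i => by
      simp only [frameError]; ring
    simp only [this, Finset.sum_sub_distrib]
    simp [Pi.single_apply]
  rw [h1, Finset.sum_congr rfl fun i _ => h3 i, Finset.sum_sub_distrib, h5]
  linarith

/-- Adding back `∂_j` costs nothing: its only nonzero component is at `k = j`, where the required
weight is `0`. -/
lemma IsEulerFrame.weight_apply (hU : IsOpen U) (h0 : (0 : ι → ℝ) ∈ U)
    (hF : IsEulerFrame w r U a F) {n : ℕ} {j k : ι}
    (h : WeightGEUpTo w n ((w k : ℤ) - w j) (frameError F j k)) :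
    WeightGEUpTo w n ((w k : ℤ) - w j) (fun u => F j u k) := by
  have hc : WeightGEUpTo w n ((w k : ℤ) - w j)
      (fun _ : ι → ℝ => (Pi.single j (1 : ℝ) : ι → ℝ) k) := by
    refine weightGEUpTo_const fun hpos => ?_
    have : k ≠ j := by rintro rfl; omega
    simp [this]
  exact (h.add hU h0 (hF.contDiffOn_frameError j k) contDiffOn_const hc).congr hU h0
    fun u _ => by simp [frameError]

/-- Structure constants only involve `l` with `w l = w i + w j`, so `F l` has exactly the weight
wanted. If `w i + w j > r`, then `w k ≤ r` makes the bound void. -/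
lemma IsEulerFrame.weight_lieBracket (hU : IsOpen U) (h0 : (0 : ι → ℝ) ∈ U) (hw : ∀ i, w i ≤ r)
    (ha : ∀ i j l, a i j l ≠ 0 → w l = w i + w j) (hF : IsEulerFrame w r U a F) {n : ℕ}
    (ih : ∀ j k, WeightGEUpTo w n ((w k : ℤ) - w j) (frameError F j k)) (i j k : ι) :
    WeightGEUpTo w n ((w k : ℤ) - w i - w j) (fun u => lieBracket ℝ (F i) (F j) u k) := by
  by_cases hij : w i + w j ≤ r
  · refine WeightGEUpTo.congr hU h0 (f := fun u => ∑ l, a i j l * F l u k)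
      (fun u hu => by simp [hF.lieBracket_eq i j hij u hu]) ?_
    refine WeightGEUpTo.sum hU h0 _ (fun l _ => contDiffOn_const.mul (hF.contDiffOn_apply l k))
      fun l _ => ?_
    by_cases hl : a i j l = 0
    · simpa [hl] using weightGEUpTo_const fun _ => rfl
    · exact (((hF.weight_apply hU h0 (ih l k)).const_mul hU h0 (hF.contDiffOn_apply l k) _)).mono
        (by have := ha i j l hl; omega)
  · exact weightGEUpTo_of_nonpos _ (by have := hw k; omega)

/-- The field `F j` has weight `≥ -w j`. -/
lemma IsEulerFrame.weight_frameError (hU : IsOpen U) (h0 : (0 : ι → ℝ) ∈ U) (hw : ∀ i, w i ≤ r)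
    (ha : ∀ i j l, a i j l ≠ 0 → w l = w i + w j) (hF : IsEulerFrame w r U a F) (n : ℕ) (j k : ι) :
    WeightGEUpTo w n ((w k : ℤ) - w j) (frameError F j k) := by
  have hz := hF.frameError_apply_zero hU h0
  have hs := hF.contDiffOn_frameError
  induction n generalizing j k with
  | zero => exact fun _ => hz j k
  | succ n ih =>
    -- On the right of the Euler equation each term gains an order over `ih`. The weights add up to
    -- `(w k - w i - w j) + w i` for the bracket terms and `(w i - w j) + (w k - w i)` for the
    -- quadratic ones.
    refine WeightGEUpTo.of_euler hU h0 (hs j k) one_pos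
      (WeightGEUpTo.congr hU h0 (fun u hu => (hF.euler_frameError hU hu j k).symm) ?_)
    refine WeightGEUpTo.sub hU h0
      (ContDiffOn.sum fun i _ => (hF.contDiffOn_lieBracket_apply hU i j k).mul (by fun_prop))
      (ContDiffOn.sum fun i _ => (hs j i).mul (hs i k)) ?_ ?_
    · refine WeightGEUpTo.sum hU h0 _
        (fun i _ => (hF.contDiffOn_lieBracket_apply hU i j k).mul (by fun_prop)) fun i _ => ?_
      exact ((hF.weight_lieBracket hU h0 hw ha ih i j k).mul_of_apply_zero hU h0
        (hF.contDiffOn_lieBracket_apply hU i j k) (by fun_prop) (weightGEUpTo_coord i) rfl).mono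
        (by omega)
    · refine WeightGEUpTo.sum hU h0 _ (fun i _ => (hs j i).mul (hs i k)) fun i _ => ?_
      exact ((ih j i).mul_of_apply_zero_of_apply_zero hU h0 (hs j i) (hs i k) (ih i k)
        (hz j i) (hz i k)).mono (by omega)

lemma IsEulerFrame.weight_lieBracket_sub (hU : IsOpen U) (h0 : (0 : ι → ℝ) ∈ U)
    (hw : ∀ i, w i ≤ r) (ha : ∀ i j l, a i j l ≠ 0 → w l = w i + w j)
    (hF : IsEulerFrame w r U a F) (hG : IsEulerFrame w r U a G) {n : ℕ}
    (ih : ∀ j k, WeightGEUpTo w n ((w k : ℤ) - w j + 1) (fun u => F j u k - G j u k)) (i j k : ι) :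
    WeightGEUpTo w n ((w k : ℤ) - w i - w j + 1)
      (fun u => lieBracket ℝ (F i) (F j) u k - lieBracket ℝ (G i) (G j) u k) := by
  have hs : ∀ l, ContDiffOn ℝ ∞ (fun u => F l u k - G l u k) U := fun l =>
    (hF.contDiffOn_apply l k).sub (hG.contDiffOn_apply l k)
  by_cases hij : w i + w j ≤ r
  · refine WeightGEUpTo.congr hU h0 (f := fun u => ∑ l, a i j l * (F l u k - G l u k))
      (fun u hu => by
        simp [hF.lieBracket_eq i j hij u hu, hG.lieBracket_eq i j hij u hu, mul_sub]) ?_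
    refine WeightGEUpTo.sum hU h0 _ (fun l _ => contDiffOn_const.mul (hs l)) fun l _ => ?_
    by_cases hl : a i j l = 0
    · simpa [hl] using weightGEUpTo_const fun _ => rfl
    · exact ((ih l k).const_mul hU h0 (hs l) _).mono (by have := ha i j l hl; omega)
  -- Here `w k ≤ r < w i + w j`; the strict inequality absorbs the extra `1`.
  · exact weightGEUpTo_of_nonpos _ (by have := hw k; omega)

/-- Two frames with the same structure constants agree up to weight `1 - w j`. -/
theorem IsEulerFrame.weight_sub (hU : IsOpen U) (h0 : (0 : ι → ℝ) ∈ U) (hw : ∀ i, w i ≤ r)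
    (ha : ∀ i j l, a i j l ≠ 0 → w l = w i + w j) (hF : IsEulerFrame w r U a F)
    (hG : IsEulerFrame w r U a G) (n : ℕ) (j k : ι) :
    WeightGEUpTo w n ((w k : ℤ) - w j + 1) (fun u => F j u k - G j u k) := by
  have hFz := hF.frameError_apply_zero hU h0
  have hGz := hG.frameError_apply_zero hU h0
  have hFs := hF.contDiffOn_frameError
  have hGs := hG.contDiffOn_frameError
  have hs : ∀ j k, ContDiffOn ℝ ∞ (fun u => F j u k - G j u k) U := fun j k =>
    (hF.contDiffOn_apply j k).sub (hG.contDiffOn_apply j k)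
  have hbs : ∀ i k, ContDiffOn ℝ ∞
      (fun u => lieBracket ℝ (F i) (F j) u k - lieBracket ℝ (G i) (G j) u k) U := fun i k =>
    (hF.contDiffOn_lieBracket_apply hU i j k).sub (hG.contDiffOn_lieBracket_apply hU i j k)
  have hdiff : ∀ j k u, F j u k - G j u k = frameError F j k u - frameError G j k u := by
    intro j k u; simp [frameError]
  have hz : ∀ j k, F j 0 k - G j 0 k = 0 := fun j k => by rw [hdiff, hFz, hGz, sub_zero]
  induction n generalizing j k with
  | zero => exact fun _ => hz j k
  | succ n ih =>
    have ih' : ∀ j k, WeightGEUpTo w n ((w k : ℤ) - w j + 1) (fun u => F j u k - G j u k) :=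
      fun j k => ih j k fun i k =>
        (hF.contDiffOn_lieBracket_apply hU i j k).sub (hG.contDiffOn_lieBracket_apply hU i j k)
    -- The difference of the two Euler equations, with the quadratic terms split as `ff' - gg' =
    -- f(f' - g') + (f - g)g'`. Each product contains one difference, which carries the extra weight
    -- `1`.
    refine WeightGEUpTo.of_euler hU h0 (hs j k) one_pos (WeightGEUpTo.congr hU h0
      (f := fun u => ∑ i, (lieBracket ℝ (F i) (F j) u k - lieBracket ℝ (G i) (G j) u k) * u i
        - ∑ i, (frameError F j i u * (F i u k - G i u k)
          + (F j u i - G j u i) * frameError G i k u)) (fun u hu => ?_) ?_)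
    · have e1 := hF.euler_frameError hU hu j k
      have e2 := hG.euler_frameError hU hu j k
      have e3 : fderiv ℝ (fun u => F j u k - G j u k) u =
          fderiv ℝ (frameError F j k) u - fderiv ℝ (frameError G j k) u := by
        simp only [hdiff]
        exact fderiv_fun_sub (differentiableAt_of_contDiffOn hU (hFs j k) hu)
          (differentiableAt_of_contDiffOn hU (hGs j k) hu)
      have e4 : ∀ i, frameError F j i u * (F i u k - G i u k)
          + (F j u i - G j u i) * frameError G i k u = frameError F j i u * frameError F i k u
            - frameError G j i u * frameError G i k u := fun i => by
        rw [hdiff, hdiff]; ring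
      simp only [e3, e4]
      simp only [sub_mul, Finset.sum_sub_distrib, sub_apply]
      rw [hdiff]
      linarith
    · refine WeightGEUpTo.sub hU h0
        (ContDiffOn.sum fun i _ => (hbs i k).mul (by fun_prop))
        (ContDiffOn.sum fun i _ => ((hFs j i).mul (hs i k)).add ((hs j i).mul (hGs i k))) ?_ ?_
      · refine WeightGEUpTo.sum hU h0 _ (fun i _ => (hbs i k).mul (by fun_prop)) fun i _ => ?_
        exact ((hF.weight_lieBracket_sub hU h0 hw ha hG ih' i j k).mul_of_apply_zero hU h0
          (hbs i k) (by fun_prop) (weightGEUpTo_coord i) rfl).mono (by omega)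
      · refine WeightGEUpTo.sum hU h0 _
          (fun i _ => ((hFs j i).mul (hs i k)).add ((hs j i).mul (hGs i k))) fun i _ => ?_
        refine WeightGEUpTo.add hU h0 ((hFs j i).mul (hs i k)) ((hs j i).mul (hGs i k)) ?_ ?_
        · exact ((hF.weight_frameError hU h0 hw ha n j i).mul_of_apply_zero_of_apply_zero hU h0
            (hFs j i) (hs i k) (ih' i k) (hFz j i) (hz i k)).mono (by omega)
        · exact ((ih' j i).mul_of_apply_zero_of_apply_zero hU h0 (hs j i) (hGs i k)
            (hG.weight_frameError hU h0 hw ha n i k) (hz j i) (hGz i k)).mono (by omega)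

end EulerFrame

/-! ### Iterated commutators in the free algebra, and the algebraic content of freeness. -/

section FreeBrackets

variable {n : ℕ}

/-- The iterated commutator `ξ_[I]` of the noncommuting variables. -/
def freeBracket (I : List (Fin (n + 1))) : FreeAlgebra ℝ (Fin (n + 1)) :=
  nested (fun a b => a * b - b * a) (FreeAlgebra.ι ℝ) I

lemma freeBracket_cons (i : Fin (n + 1)) {I : List (Fin (n + 1))} (hI : I ≠ []) :
    freeBracket (i :: I) =
      FreeAlgebra.ι ℝ i * freeBracket I - freeBracket I * FreeAlgebra.ι ℝ i := by
  cases I with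
  | nil => exact absurd rfl hI
  | cons j I => rfl

lemma weight_cons (i : Fin (n + 1)) (I : List (Fin (n + 1))) :
    weight (i :: I) = indexWeight i + weight I := by
  simp [weight]

/-- The span of the iterated commutators of weight `v`. -/
def freeBracketSpan (n v : ℕ) : Submodule ℝ (FreeAlgebra ℝ (Fin (n + 1))) :=
  Submodule.span ℝ (freeBracket '' {K : List (Fin (n + 1)) | K ≠ [] ∧ weight K = v})

lemma freeBracket_mem_span {I : List (Fin (n + 1))} (hI : I ≠ []) :
    freeBracket I ∈ freeBracketSpan n (weight I) :=
  Submodule.subset_span ⟨I, ⟨hI, rfl⟩, rfl⟩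

lemma commutator_ι_mem_span (i : Fin (n + 1)) {v : ℕ} {x : FreeAlgebra ℝ (Fin (n + 1))}
    (hx : x ∈ freeBracketSpan n v) :
    FreeAlgebra.ι ℝ i * x - x * FreeAlgebra.ι ℝ i ∈ freeBracketSpan n (indexWeight i + v) := by
  induction hx using Submodule.span_induction with
  | mem x hx =>
    obtain ⟨K, ⟨hK, rfl⟩, rfl⟩ := hx
    rw [← freeBracket_cons i hK, ← weight_cons]
    exact freeBracket_mem_span (by simp)
  | zero => simp
  | add x y _ _ hx hy =>
    convert add_mem hx hy using 1
    noncomm_ring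
  | smul c x _ hx =>
    convert Submodule.smul_mem _ c hx using 1
    simp [smul_sub]

/-- Commutators of iterated commutators are combinations of iterated commutators. -/
lemma commutator_mem_span {I J : List (Fin (n + 1))} (hI : I ≠ []) (hJ : J ≠ []) :
    freeBracket I * freeBracket J - freeBracket J * freeBracket I ∈
      freeBracketSpan n (weight I + weight J) := by
  induction I generalizing J with
  | nil => exact absurd rfl hI
  | cons i I ih =>
    by_cases hI' : I = []
    · subst hI'
      have : freeBracket [i] = FreeAlgebra.ι ℝ i := rfl
      rw [this, ← freeBracket_cons i hJ]
      have h := freeBracket_mem_span (I := i :: J) (by simp)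
      rwa [weight_cons] at h
    -- Jacobi: `[[ξ_i, x], y] = [ξ_i, [x, y]] - [x, [ξ_i, y]]`. The last term is the induction
    -- hypothesis for `I` with `J` replaced by `i :: J`.
    · have h1 := commutator_ι_mem_span i (ih hI' hJ)
      have h2 := ih hI' (J := i :: J) (by simp)
      rw [freeBracket_cons i hJ, weight_cons] at h2
      rw [freeBracket_cons i hI', weight_cons]
      rw [show indexWeight i + (weight I + weight J) = indexWeight i + weight I + weight J by ring]
        at h1
      rw [show weight I + (indexWeight i + weight J) = indexWeight i + weight I + weight J by ring]
        at h2
      convert sub_mem h1 h2 using 1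
      noncomm_ring

/-- The monomials of `x` all have weight `v`. -/
def IsHomogeneous (v : ℕ) (x : MonoidAlgebra ℝ (FreeMonoid (Fin (n + 1)))) : Prop :=
  ∀ m, x.coeff m ≠ 0 → weight (FreeMonoid.toList m) = v

lemma IsHomogeneous.sub {v : ℕ} {x y : MonoidAlgebra ℝ (FreeMonoid (Fin (n + 1)))}
    (hx : IsHomogeneous v x) (hy : IsHomogeneous v y) : IsHomogeneous v (x - y) := by
  intro m hm
  by_cases h : x.coeff m = 0
  · refine hy m fun h' => hm ?_
    simp [h, h']
  · exact hx m h

lemma IsHomogeneous.mul {v v' : ℕ} {x y : MonoidAlgebra ℝ (FreeMonoid (Fin (n + 1)))}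
    (hx : IsHomogeneous v x) (hy : IsHomogeneous v' y) : IsHomogeneous (v + v') (x * y) := by
  classical
  intro m hm
  rw [MonoidAlgebra.coeff_mul, Finsupp.sum] at hm
  obtain ⟨m₁, h₁, hm⟩ := Finset.exists_ne_zero_of_sum_ne_zero hm
  rw [Finsupp.sum] at hm
  obtain ⟨m₂, h₂, hm⟩ := Finset.exists_ne_zero_of_sum_ne_zero hm
  have h : m₁ * m₂ = m := by
    by_contra h
    simp [h] at hm
  have e1 := hx m₁ (Finsupp.mem_support_iff.1 h₁)
  have e2 := hy m₂ (Finsupp.mem_support_iff.1 h₂)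
  rw [← h, ← e1, ← e2]
  simp [weight, FreeMonoid.toList_mul]

lemma isHomogeneous_freeBracket {I : List (Fin (n + 1))} (hI : I ≠ []) :
    IsHomogeneous (weight I) (FreeAlgebra.equivMonoidAlgebraFreeMonoid (freeBracket I)) := by
  have hι : ∀ i : Fin (n + 1), IsHomogeneous (indexWeight i)
      (FreeAlgebra.equivMonoidAlgebraFreeMonoid (FreeAlgebra.ι ℝ i)) := by
    classical
    intro i m hm
    have : FreeAlgebra.equivMonoidAlgebraFreeMonoid (FreeAlgebra.ι ℝ i) =
        MonoidAlgebra.of ℝ (FreeMonoid (Fin (n + 1))) (.of i) := by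
      simp [FreeAlgebra.equivMonoidAlgebraFreeMonoid]
    rw [this, MonoidAlgebra.of_apply, MonoidAlgebra.coeff_single, Finsupp.single_apply] at hm
    have hm' : FreeMonoid.of i = m := by
      by_contra h
      simp [h] at hm
    simp [← hm', weight]
  induction I with
  | nil => exact absurd rfl hI
  | cons i I ih =>
    by_cases hI' : I = []
    · subst hI'
      have := hι i
      simp only [weight, List.map_cons, List.map_nil, List.sum_cons, List.sum_nil, add_zero]
      exact this
    · rw [freeBracket_cons i hI', map_sub, map_mul, map_mul, weight_cons]
      refine ((hι i).mul (ih hI')).sub ?_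
      rw [add_comm]
      exact (ih hI').mul (hι i)

/-- This grading allows a relation between the coefficients to be split by weight. -/
lemma universalCoeff_eq_zero {I J : List (Fin (n + 1))} (hI : I ≠ [])
    (h : weight J ≠ weight I) : universalCoeff I J = 0 := by
  by_contra hne
  exact h (isHomogeneous_freeBracket hI (FreeMonoid.ofList J) hne)

variable {E : Type*} [NormedAddCommGroup E] [NormedSpace ℝ E]

lemma sum_single_sub_sum_single_smul {α M : Type*} [AddCommGroup M] [Module ℝ M] (B : Finset α)
    (K : α) (c : B → ℝ) (φ : α → M) :
    ((Finsupp.single K 1 - ∑ L : B, Finsupp.single (L : α) (c L)).sum fun I d => d • φ I) =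
      φ K - ∑ L : B, c L • φ L := by
  rw [← Finsupp.linearCombination_apply]
  simp [map_sub, map_sum]

/-- For a free system, an iterated commutator of weight `≤ r` is a combination of those of the same
weight indexed by a set `B` for which the `X_[I]` span at the base point. -/
lemma exists_freeBracket_eq_sum {X : Fin (n + 1) → E → E} {r : ℕ} {x : E}
    (hfree : IsFreeUpToWeightAt X r x) {B : Finset (List (Fin (n + 1)))}
    (hB : ∀ I ∈ B, I ≠ [] ∧ weight I ≤ r)
    (hBspan : Submodule.span ℝ (Set.range fun I : B => bracket X (I : List (Fin (n + 1))) x) = ⊤)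
    {K : List (Fin (n + 1))} (hK : K ≠ []) (hKr : weight K ≤ r) :
    ∃ b : B → ℝ, (∀ L, b L ≠ 0 → weight (L : List (Fin (n + 1))) = weight K) ∧
      freeBracket K = ∑ L : B, b L • freeBracket (L : List (Fin (n + 1))) := by
  classical
  obtain ⟨c, hc⟩ := (Submodule.mem_span_range_iff_exists_fun ℝ).1
    (hBspan ▸ Submodule.mem_top : bracket X K x ∈
      Submodule.span ℝ (Set.range fun I : B => bracket X (I : List (Fin (n + 1))) x))
  -- The relation `X_[K] - ∑ c_L X_[L] = 0` at `x`, to which freeness is applied.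
  let a : List (Fin (n + 1)) →₀ ℝ :=
    Finsupp.single K 1 - ∑ L : B, Finsupp.single (L : List (Fin (n + 1))) (c L)
  have hsupp : ∀ I ∈ a.support, I ≠ [] ∧ weight I ≤ r := by
    intro I hI
    by_contra hcon
    refine Finsupp.mem_support_iff.1 hI ?_
    have h1 : K ≠ I := by rintro rfl; exact hcon ⟨hK, hKr⟩
    have h2 : ∀ L : B, (L : List (Fin (n + 1))) ≠ I := by
      rintro L rfl; exact hcon (hB _ L.2)
    simp [a, h1, h2]
  have key := hfree a hsupp (by rw [sum_single_sub_sum_single_smul, hc, sub_self])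
  have key' : ∀ J, universalCoeff K J
      = ∑ L : B, c L * universalCoeff (L : List (Fin (n + 1))) J := by
    intro J
    have h1 := key J
    have h2 := sum_single_sub_sum_single_smul B K c (fun I => universalCoeff I J)
    simp only [smul_eq_mul] at h2
    rw [h2] at h1
    exact sub_eq_zero.1 h1
  -- The expansion at the single point `x` may mix weights. Only the terms of the weight of `K` are
  -- kept: the others contribute no monomial of that weight.
  refine ⟨fun L => if weight (L : List (Fin (n + 1))) = weight K then c L else 0,
    fun L hL => by by_contra h; simp [h] at hL, ?_⟩
  apply FreeAlgebra.equivMonoidAlgebraFreeMonoid.injective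
  ext m
  simp only [map_sum, map_smul, MonoidAlgebra.coeff_sum, MonoidAlgebra.coeff_smul,
    Finsupp.finsetSum_apply, Finsupp.smul_apply, smul_eq_mul]
  change universalCoeff K (FreeMonoid.toList m) = ∑ L : B, _ * universalCoeff _ (FreeMonoid.toList m)
  by_cases hm : weight (FreeMonoid.toList m) = weight K
  · rw [key']
    refine Finset.sum_congr rfl fun L _ => ?_
    by_cases hL : weight (L : List (Fin (n + 1))) = weight K
    · simp [hL]
    · rw [universalCoeff_eq_zero (hB _ L.2).1 (by rw [hm]; exact Ne.symm hL)]
      simp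
  · rw [universalCoeff_eq_zero hK hm]
    refine (Finset.sum_eq_zero fun L _ => ?_).symm
    by_cases hL : weight (L : List (Fin (n + 1))) = weight K
    · rw [universalCoeff_eq_zero (hB _ L.2).1 (by rwa [hL]), mul_zero]
    · simp [hL]

lemma exists_eq_sum_of_mem_span {X : Fin (n + 1) → E → E} {r : ℕ} {x : E}
    (hfree : IsFreeUpToWeightAt X r x) {B : Finset (List (Fin (n + 1)))}
    (hB : ∀ I ∈ B, I ≠ [] ∧ weight I ≤ r)
    (hBspan : Submodule.span ℝ (Set.range fun I : B => bracket X (I : List (Fin (n + 1))) x) = ⊤)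
    {v : ℕ} (hv : v ≤ r) {y : FreeAlgebra ℝ (Fin (n + 1))} (hy : y ∈ freeBracketSpan n v) :
    ∃ b : B → ℝ, (∀ L, b L ≠ 0 → weight (L : List (Fin (n + 1))) = v) ∧
      y = ∑ L : B, b L • freeBracket (L : List (Fin (n + 1))) := by
  induction hy using Submodule.span_induction with
  | mem y hy =>
    obtain ⟨K, ⟨hK, rfl⟩, rfl⟩ := hy
    exact exists_freeBracket_eq_sum hfree hB hBspan hK hv
  | zero => exact ⟨0, by simp, by simp⟩
  | add y z _ _ hy hz =>
    obtain ⟨b, hb, rfl⟩ := hy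
    obtain ⟨c, hc, rfl⟩ := hz
    refine ⟨b + c, fun L hL => ?_, by simp [add_smul, Finset.sum_add_distrib]⟩
    by_cases h : b L = 0
    · exact hc L fun h' => hL (by simp [h, h'])
    · exact hb L h
  | smul d y _ hy =>
    obtain ⟨b, hb, rfl⟩ := hy
    exact ⟨d • b, fun L hL => hb L fun h => hL (by simp [h]), by simp [Finset.smul_sum, mul_smul]⟩

end FreeBrackets

/-! ### Transfer of free-algebra identities to vector fields acting on functions. -/

section LieDerivative

open VectorField

variable {E : Type*} [NormedAddCommGroup E] [NormedSpace ℝ E] {U : Set E} {n : ℕ}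

/-- The real functions that are smooth on `U`. -/
def smoothFunctions (U : Set E) : Submodule ℝ (E → ℝ) where
  carrier := {f | ContDiffOn ℝ ∞ f U}
  add_mem' hf hg := hf.add hg
  zero_mem' := contDiffOn_const
  smul_mem' _ _ hf := contDiffOn_const.smul hf

/-- The derivative along the vector field `Z` as an operator on functions smooth on `U`. -/
def lieDerivative (hU : IsOpen U) (Z : E → E) (hZ : ContDiffOn ℝ ∞ Z U) :
    Module.End ℝ (smoothFunctions U) where
  -- Set to zero off `U`, where `f` need not be differentiable and the default value of `fderiv`
  -- would spoil additivity.
  toFun f := ⟨U.indicator fun u => fderiv ℝ f u (Z u),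
    (contDiffOn_fderiv_apply hU f.2 hZ).congr fun _ hu => Set.indicator_of_mem hu _⟩
  map_add' f g := by
    ext u
    by_cases hu : u ∈ U
    · simp [hu, fderiv_add (differentiableAt_of_contDiffOn hU f.2 hu)
        (differentiableAt_of_contDiffOn hU g.2 hu)]
    · simp [hu]
  map_smul' c f := by
    ext u
    by_cases hu : u ∈ U
    · simp [hu, fderiv_const_smul (differentiableAt_of_contDiffOn hU f.2 hu)]
    · simp [hu]

lemma lieDerivative_apply {hU : IsOpen U} {Z : E → E} {hZ : ContDiffOn ℝ ∞ Z U}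
    (f : smoothFunctions U) {u : E} (hu : u ∈ U) :
    (lieDerivative hU Z hZ f : E → ℝ) u = fderiv ℝ f u (Z u) :=
  Set.indicator_of_mem hu fun u => fderiv ℝ (f : E → ℝ) u (Z u)

lemma lieDerivative_apply_of_notMem {hU : IsOpen U} {Z : E → E} {hZ : ContDiffOn ℝ ∞ Z U}
    (f : smoothFunctions U) {u : E} (hu : u ∉ U) :
    (lieDerivative hU Z hZ f : E → ℝ) u = 0 :=
  Set.indicator_of_notMem hu fun u => fderiv ℝ (f : E → ℝ) u (Z u)

lemma fderiv_lieDerivative {hU : IsOpen U} {Z : E → E} {hZ : ContDiffOn ℝ ∞ Z U}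
    (f : smoothFunctions U) {u : E} (hu : u ∈ U) :
    fderiv ℝ (lieDerivative hU Z hZ f : E → ℝ) u = fderiv ℝ (fun v => fderiv ℝ f v (Z v)) u := by
  refine Filter.EventuallyEq.fderiv_eq ?_
  filter_upwards [hU.mem_nhds hu] with v hv using lieDerivative_apply f hv

lemma lieDerivative_lieBracket (hU : IsOpen U) {V W : E → E} (hV : ContDiffOn ℝ ∞ V U)
    (hW : ContDiffOn ℝ ∞ W U) :
    lieDerivative hU (lieBracket ℝ V W) (contDiffOn_lieBracket hU hV hW) =
      lieDerivative hU V hV * lieDerivative hU W hW -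
        lieDerivative hU W hW * lieDerivative hU V hV := by
  ext f u
  simp only [LinearMap.sub_apply, Module.End.mul_apply, Submodule.coe_sub, Pi.sub_apply]
  by_cases hu : u ∈ U
  · rw [lieDerivative_apply _ hu, lieDerivative_apply _ hu, lieDerivative_apply _ hu,
      fderiv_lieDerivative _ hu, fderiv_lieDerivative _ hu]
    exact fderiv_apply_lieBracket (n := ∞) (f.2.contDiffAt (hU.mem_nhds hu))
      (by simpa using (WithTop.coe_le_coe.2 le_top : (2 : ℕ∞ω) ≤ ∞))
      (differentiableAt_of_contDiffOn hU hW hu) (differentiableAt_of_contDiffOn hU hV hu)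
  · simp [lieDerivative_apply_of_notMem _ hu]

lemma bracket_cons (X : Fin (n + 1) → E → E) (i : Fin (n + 1)) {I : List (Fin (n + 1))}
    (hI : I ≠ []) : bracket X (i :: I) = lieBracket ℝ (X i) (bracket X I) := by
  cases I with
  | nil => exact absurd rfl hI
  | cons j I => rfl

lemma contDiffOn_bracket (hU : IsOpen U) {X : Fin (n + 1) → E → E}
    (hX : ∀ i, ContDiffOn ℝ ∞ (X i) U) (I : List (Fin (n + 1))) :
    ContDiffOn ℝ ∞ (bracket X I) U := by
  induction I with
  | nil => exact contDiffOn_const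
  | cons i I ih =>
    by_cases hI : I = []
    · subst hI; exact hX i
    · rw [bracket_cons X i hI]; exact contDiffOn_lieBracket hU (hX i) ih

/-- The free algebra acting on smooth functions through the vector fields `X i`. -/
def fieldAction (hU : IsOpen U) {X : Fin (n + 1) → E → E} (hX : ∀ i, ContDiffOn ℝ ∞ (X i) U) :
    FreeAlgebra ℝ (Fin (n + 1)) →ₐ[ℝ] Module.End ℝ (smoothFunctions U) :=
  FreeAlgebra.lift ℝ fun i => lieDerivative hU (X i) (hX i)

/-- Iterated commutators of symbols act as iterated brackets of fields, so an identity in the free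
algebra holds for every system of smooth fields, with the same constants. -/
lemma fieldAction_freeBracket (hU : IsOpen U) {X : Fin (n + 1) → E → E}
    (hX : ∀ i, ContDiffOn ℝ ∞ (X i) U) {I : List (Fin (n + 1))} (hI : I ≠ []) :
    fieldAction hU hX (freeBracket I) =
      lieDerivative hU (bracket X I) (contDiffOn_bracket hU hX I) := by
  have hι : ∀ i, fieldAction hU hX (FreeAlgebra.ι ℝ i) = lieDerivative hU (X i) (hX i) := fun i =>
    FreeAlgebra.lift_ι_apply _ _
  induction I with
  | nil => exact absurd rfl hI
  | cons i I ih =>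
    by_cases hI' : I = []
    · subst hI'; exact hι i
    · rw [freeBracket_cons i hI', map_sub, map_mul, map_mul, hι, ih hI']
      simp only [bracket_cons X i hI']
      rw [lieDerivative_lieBracket hU (hX i) (contDiffOn_bracket hU hX I)]

/-- A field is recovered from its derivation by applying it to the coordinate functions. -/
lemma eq_sum_of_lieDerivative_eq_sum {ι α : Type*} [Fintype ι] [Fintype α] {U : Set (ι → ℝ)}
    (hU : IsOpen U) {Z : (ι → ℝ) → (ι → ℝ)} (hZ : ContDiffOn ℝ ∞ Z U)
    {W : α → (ι → ℝ) → (ι → ℝ)} (hW : ∀ l, ContDiffOn ℝ ∞ (W l) U) {b : α → ℝ}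
    (h : lieDerivative hU Z hZ = ∑ l, b l • lieDerivative hU (W l) (hW l)) {u : ι → ℝ}
    (hu : u ∈ U) : Z u = ∑ l, b l • W l u := by
  ext k
  let f : smoothFunctions U := ⟨fun u => u k, (contDiff_apply ℝ ℝ k).contDiffOn⟩
  have hf : ∀ v, fderiv ℝ (f : (ι → ℝ) → ℝ) u v = v k := fun v => by
    have := (ContinuousLinearMap.proj (R := ℝ) (φ := fun _ : ι => ℝ) k).hasFDerivAt (x := u)
    exact congrArg (fun L : (ι → ℝ) →L[ℝ] ℝ => L v) this.fderiv
  have h1 := congrArg (fun T : Module.End ℝ (smoothFunctions U) => (T f : (ι → ℝ) → ℝ) u) h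
  simp only [lieDerivative_apply f hu, hf, LinearMap.sum_apply, LinearMap.smul_apply,
    Submodule.coe_sum, Submodule.coe_smul, Finset.sum_apply, Pi.smul_apply] at h1
  simpa using h1

variable {ι : Type*} [Fintype ι] {U : Set (ι → ℝ)} {X : Fin (n + 1) → (ι → ℝ) → (ι → ℝ)}
  {B : Finset (List (Fin (n + 1)))}

lemma bracket_eq_sum (hU : IsOpen U) (hX : ∀ i, ContDiffOn ℝ ∞ (X i) U) (hB : ∀ I ∈ B, I ≠ [])
    {K : List (Fin (n + 1))} (hK : K ≠ []) {b : B → ℝ}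
    (h : freeBracket K = ∑ L : B, b L • freeBracket (L : List (Fin (n + 1)))) {u : ι → ℝ}
    (hu : u ∈ U) : bracket X K u = ∑ L : B, b L • bracket X (L : List (Fin (n + 1))) u := by
  refine eq_sum_of_lieDerivative_eq_sum hU (contDiffOn_bracket hU hX K)
    (fun L : B => contDiffOn_bracket hU hX L) ?_ hu
  rw [← fieldAction_freeBracket hU hX hK, h, map_sum]
  refine Finset.sum_congr rfl fun L _ => ?_
  rw [map_smul, fieldAction_freeBracket hU hX (hB _ L.2)]

lemma lieBracket_bracket_eq_sum (hU : IsOpen U) (hX : ∀ i, ContDiffOn ℝ ∞ (X i) U)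
    (hB : ∀ I ∈ B, I ≠ []) {I J : List (Fin (n + 1))} (hI : I ≠ []) (hJ : J ≠ []) {b : B → ℝ}
    (h : freeBracket I * freeBracket J - freeBracket J * freeBracket I =
      ∑ L : B, b L • freeBracket (L : List (Fin (n + 1)))) {u : ι → ℝ} (hu : u ∈ U) :
    lieBracket ℝ (bracket X I) (bracket X J) u =
      ∑ L : B, b L • bracket X (L : List (Fin (n + 1))) u := by
  refine eq_sum_of_lieDerivative_eq_sum hU
    (contDiffOn_lieBracket hU (contDiffOn_bracket hU hX I) (contDiffOn_bracket hU hX J))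
    (fun L : B => contDiffOn_bracket hU hX L) ?_ hu
  rw [lieDerivative_lieBracket hU (contDiffOn_bracket hU hX I) (contDiffOn_bracket hU hX J),
    ← fieldAction_freeBracket hU hX hI, ← fieldAction_freeBracket hU hX hJ]
  have key := congrArg (fieldAction hU hX) h
  rw [map_sub, map_mul, map_mul, map_sum] at key
  rw [key]
  refine Finset.sum_congr rfl fun L _ => ?_
  rw [map_smul, fieldAction_freeBracket hU hX (hB _ L.2)]

end LieDerivative

/-! ### Canonical coordinates: pulling back fields and the Euler identity. -/

section CanonicalCoordinates

open VectorField

/-- Integral curves of a smooth vector field on `[0, 1]` are determined by their initial value. -/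
lemma integralCurveOn_unique {E : Type*} [NormedAddCommGroup E] [NormedSpace ℝ E] {Ω : Set E}
    (hΩ : IsOpen Ω) {Z : E → E} (hZ : ContDiffOn ℝ ∞ Z Ω) {φ ψ : ℝ → E}
    (hφ : IsIntegralCurveOn φ (fun _ => Z) (Set.Icc 0 1))
    (hψ : IsIntegralCurveOn ψ (fun _ => Z) (Set.Icc 0 1))
    (hφΩ : ∀ τ ∈ Set.Icc (0 : ℝ) 1, φ τ ∈ Ω) (hψΩ : ∀ τ ∈ Set.Icc (0 : ℝ) 1, ψ τ ∈ Ω)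
    (h0 : φ 0 = ψ 0) : Set.EqOn φ ψ (Set.Icc 0 1) := by
  have hφc : ContinuousOn φ (Set.Icc 0 1) := fun τ hτ => (hφ τ hτ).continuousWithinAt
  have hψc : ContinuousOn ψ (Set.Icc 0 1) := fun τ hτ => (hψ τ hτ).continuousWithinAt
  -- `Z` is only locally Lipschitz on `Ω`; a single constant is available on the compact union of
  -- the two trajectories.
  set S : Set E := φ '' Set.Icc 0 1 ∪ ψ '' Set.Icc 0 1
  have hScomp : IsCompact S := (isCompact_Icc.image_of_continuousOn hφc).union
    (isCompact_Icc.image_of_continuousOn hψc)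
  have hSΩ : S ⊆ Ω := by
    rintro _ (⟨τ, hτ, rfl⟩ | ⟨τ, hτ, rfl⟩)
    exacts [hφΩ τ hτ, hψΩ τ hτ]
  obtain ⟨K, hK⟩ := LocallyLipschitzOn.exists_lipschitzOnWith_of_compact (f := Z) hScomp (by
    intro x hx
    obtain ⟨K, t, ht, hK⟩ := ((hZ.contDiffAt (hΩ.mem_nhds (hSΩ hx))).of_le
      (by simp : (1 : ℕ∞ω) ≤ ∞)).exists_lipschitzOnWith
    exact ⟨K, t, mem_nhdsWithin_of_mem_nhds ht, hK⟩)
  have hder : ∀ {χ : ℝ → E}, IsIntegralCurveOn χ (fun _ => Z) (Set.Icc 0 1) →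
      ∀ τ ∈ Set.Ico (0 : ℝ) 1, HasDerivWithinAt χ (Z (χ τ)) (Set.Ici τ) τ := fun hχ τ hτ =>
    (hχ τ (Set.Ico_subset_Icc_self hτ)).mono_of_mem_nhdsWithin
      (Filter.mem_of_superset (Icc_mem_nhdsGE hτ.2) (Set.Icc_subset_Icc_left hτ.1))
  exact ODE_solution_unique_of_mem_Icc_right (v := fun _ => Z) (s := fun _ => S) (K := K)
    (fun _ _ => hK) hφc (hder hφ)
    (fun τ hτ => Or.inl ⟨τ, Set.Ico_subset_Icc_self hτ, rfl⟩) hψc (hder hψ)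
    (fun τ hτ => Or.inr ⟨τ, Set.Ico_subset_Icc_self hτ, rfl⟩) h0

variable {E : Type*} [NormedAddCommGroup E] [NormedSpace ℝ E] {n : ℕ} {Ω : Set E}
  {X : Fin (n + 1) → E → E} {B : Finset (List (Fin (n + 1)))} {xbar : E}
  {e : OpenPartialHomeomorph E (B → ℝ)}

lemma IsCanonicalCoordinates.fderiv_fderiv_symm (he : IsCanonicalCoordinates Ω X B xbar e) {u : B → ℝ}
    (hu : u ∈ e.target) (v : B → ℝ) :
    fderiv ℝ e (e.symm u) (fderiv ℝ e.symm u v) = v := by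
  have h1 := differentiableAt_of_contDiffOn e.open_source he.smooth (e.map_target hu)
  have h2 := differentiableAt_of_contDiffOn e.open_target he.smooth_symm hu
  have h3 : (e ∘ e.symm) =ᶠ[nhds u] id := by
    filter_upwards [e.open_target.mem_nhds hu] with v hv using e.right_inv hv
  have h4 := h3.fderiv_eq (𝕜 := ℝ)
  rw [fderiv_comp u h1 h2, fderiv_id] at h4
  exact congrArg (fun L : (B → ℝ) →L[ℝ] (B → ℝ) => L v) h4

lemma IsCanonicalCoordinates.fderiv_symm_fderiv (he : IsCanonicalCoordinates Ω X B xbar e)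
    {u : B → ℝ} (hu : u ∈ e.target) (x : E) :
    fderiv ℝ e.symm u (fderiv ℝ e (e.symm u) x) = x := by
  have h1 := differentiableAt_of_contDiffOn e.open_source he.smooth (e.map_target hu)
  have h2 := differentiableAt_of_contDiffOn e.open_target he.smooth_symm hu
  have h3 : (e.symm ∘ e) =ᶠ[nhds (e.symm u)] id := by
    filter_upwards [e.open_source.mem_nhds (e.map_target hu)] with v hv using e.left_inv hv
  have h4 := h3.fderiv_eq (𝕜 := ℝ)
  rw [fderiv_comp (e.symm u) (by rwa [e.right_inv hu]) h1, fderiv_id, e.right_inv hu] at h4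
  exact congrArg (fun L : E →L[ℝ] E => L x) h4

/-- `pullback` uses the inverse of the derivative, with default value `0`; the chain rule for `e`
and `e.symm` shows that it is a genuine inverse here. -/
lemma IsCanonicalCoordinates.pullback_eq (he : IsCanonicalCoordinates Ω X B xbar e) (Z : E → E)
    {u : B → ℝ} (hu : u ∈ e.target) :
    pullback ℝ e.symm Z u = fderiv ℝ e (e.symm u) (Z (e.symm u)) :=
  pullback_eq_of_fderiv_eq (M := ContinuousLinearEquiv.equivOfInverse (fderiv ℝ e.symm u)
    (fderiv ℝ e (e.symm u)) (he.fderiv_fderiv_symm hu) (he.fderiv_symm_fderiv hu)) rfl Z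

lemma IsCanonicalCoordinates.contDiffOn_pullback (he : IsCanonicalCoordinates Ω X B xbar e)
    {Z : E → E} (hZ : ContDiffOn ℝ ∞ Z Ω) :
    ContDiffOn ℝ ∞ (pullback ℝ e.symm Z) e.target := by
  have h := contDiffOn_fderiv_apply e.open_source he.smooth (hZ.mono he.source_subset)
  exact (h.comp he.smooth_symm fun u hu => e.map_target hu).congr fun u hu => he.pullback_eq Z hu

/-- The iterated brackets of the fields expressed in canonical coordinates. -/
lemma IsCanonicalCoordinates.bracket_pullback [CompleteSpace E] (hΩ : IsOpen Ω)
    (he : IsCanonicalCoordinates Ω X B xbar e) (hX : ∀ i, ContDiffOn ℝ ∞ (X i) Ω)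
    (I : List (Fin (n + 1))) : Set.EqOn (bracket (fun i => pullback ℝ e.symm (X i)) I)
      (pullback ℝ e.symm (bracket X I)) e.target := by
  induction I with
  | nil =>
    intro u hu
    rw [he.pullback_eq _ hu]
    simp [bracket, nested]
  | cons i I ih =>
    by_cases hI : I = []
    · subst hI; exact fun u _ => rfl
    · intro u hu
      have hx : e.symm u ∈ Ω := he.source_subset (e.map_target hu)
      rw [bracket_cons _ i hI, bracket_cons _ i hI,
        pullback_lieBracket (n := ∞)
          (by simpa using (WithTop.coe_le_coe.2 le_top : (2 : ℕ∞ω) ≤ ∞))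
          (he.smooth_symm.contDiffAt (e.open_target.mem_nhds hu))
          (differentiableAt_of_contDiffOn hΩ (hX i) hx)
          (differentiableAt_of_contDiffOn hΩ (contDiffOn_bracket hΩ hX I) hx)]
      exact Filter.EventuallyEq.lieBracket_vectorField_eq (Filter.EventuallyEq.refl _ _)
        (ih.eventuallyEq_of_mem (e.open_target.mem_nhds hu))

/-- In canonical coordinates `∑ u_I ∂/∂u_I = ∑ u_I X_[I]`. -/
lemma IsCanonicalCoordinates.euler (hΩ : IsOpen Ω) (he : IsCanonicalCoordinates Ω X B xbar e)
    (hX : ∀ i, ContDiffOn ℝ ∞ (X i) Ω) {u : B → ℝ}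
    (hu : ∀ τ ∈ Set.Icc (0 : ℝ) 1, τ • u ∈ e.target) :
    ∑ I : B, u I • pullback ℝ e.symm (bracket X (I : List (Fin (n + 1)))) u = u := by
  have hu1 : u ∈ e.target := by simpa using hu 1 (by simp)
  let Z : (B → ℝ) → E → E := fun u x => ∑ I : B, u I • bracket X (I : List (Fin (n + 1))) x
  have hZ : ∀ v, ContDiffOn ℝ ∞ (Z v) Ω := fun v =>
    ContDiffOn.sum fun I _ => contDiffOn_const.smul (contDiffOn_bracket hΩ hX I)
  obtain ⟨φ, hφ0, hφ1, hφΩ, hφ⟩ := he.eq_exp u hu1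
  -- `σ ↦ φ (τ * σ)` is an integral curve of `τ • Z u = Z (τ • u)`, so by uniqueness the ray through
  -- `u` is mapped onto the curve `φ`.
  have hray : ∀ τ ∈ Set.Icc (0 : ℝ) 1, e.symm (τ • u) = φ τ := by
    intro τ hτ
    obtain ⟨ψ, hψ0, hψ1, hψΩ, hψ⟩ := he.eq_exp (τ • u) (hu τ hτ)
    have hmaps : ∀ σ ∈ Set.Icc (0 : ℝ) 1, τ * σ ∈ Set.Icc (0 : ℝ) 1 := fun σ hσ =>
      ⟨mul_nonneg hτ.1 hσ.1, mul_le_one₀ hτ.2 hσ.1 hσ.2⟩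
    have hφτ : IsIntegralCurveOn (fun σ => φ (τ * σ)) (fun _ => Z (τ • u)) (Set.Icc 0 1) := by
      intro σ hσ
      have h1 : HasDerivWithinAt (fun σ : ℝ => τ * σ) τ (Set.Icc 0 1) σ := by
        simpa using ((hasDerivAt_id σ).const_mul τ).hasDerivWithinAt
      have h2 := (hφ (τ * σ) (hmaps σ hσ)).scomp σ h1 hmaps
      have h3 : Z (τ • u) (φ (τ * σ)) = τ • Z u (φ (τ * σ)) := by
        simp [Z, Finset.smul_sum, mul_smul]
      change HasDerivWithinAt _ (Z (τ • u) (φ (τ * σ))) _ _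
      rw [h3]
      exact h2
    have := integralCurveOn_unique hΩ (hZ (τ • u)) hψ hφτ hψΩ
      (fun σ hσ => hφΩ _ (hmaps σ hσ)) (by simp [hψ0, hφ0]) (Set.right_mem_Icc.2 zero_le_one)
    simpa [hψ1] using this
  have hd := differentiableAt_of_contDiffOn e.open_target he.smooth_symm hu1
  have h1 : HasDerivWithinAt φ (fderiv ℝ e.symm u u) (Set.Icc 0 1) 1 := by
    have hl : HasDerivAt (fun τ : ℝ => τ • u) u 1 := by
      simpa using (hasDerivAt_id (1 : ℝ)).smul_const u
    have hc : HasDerivAt (fun τ : ℝ => e.symm (τ • u)) (fderiv ℝ e.symm u u) 1 :=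
      HasFDerivAt.comp_hasDerivAt (1 : ℝ) (by simpa using hd.hasFDerivAt) hl
    exact hc.hasDerivWithinAt.congr (fun τ hτ => (hray τ hτ).symm)
      (hray 1 (by simp)).symm
  -- Two expressions for the one-sided derivative of `φ` at the endpoint `1`: from the ray, and from
  -- the differential equation.
  have h2 : fderiv ℝ e.symm u u = Z u (e.symm u) := by
    have := (uniqueDiffOn_Icc (zero_lt_one' ℝ) 1 (by simp)).eq_deriv _ h1 (hφ 1 (by simp))
    rw [this, hφ1]
  calc ∑ I : B, u I • pullback ℝ e.symm (bracket X (I : List (Fin (n + 1)))) u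
      = fderiv ℝ e (e.symm u) (Z u (e.symm u)) := by
        simp [Z, he.pullback_eq _ hu1, map_sum]
    _ = u := by rw [← h2, he.fderiv_fderiv_symm hu1]

end CanonicalCoordinates

end WeightedFields

end

/-! ### The main theorem. -/

open WeightedFields

theorem mainTheorem7 {p n r : ℕ}
    -- smooth vector fields `X_0, …, X_n` on an open `Ω ⊆ ℝ^p`, free up to weight `r` at `xbar`
    (Ω : Set (Fin p → ℝ)) (hΩ : IsOpen Ω) (xbar : Fin p → ℝ) (hxbar : xbar ∈ Ω)
    (X : Fin (n + 1) → (Fin p → ℝ) → (Fin p → ℝ))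
    (hX : ∀ i, ContDiffOn ℝ ∞ (X i) Ω)
    (hfree : WeightedFields.IsFreeUpToWeightAt X r xbar)
    -- multiindices of weight `≤ r` such that `((X_[I])_xbar)_{I ∈ B}` is a basis of `ℝ^p`
    (B : Finset (List (Fin (n + 1))))
    (hB : ∀ I ∈ B, I ≠ [] ∧ WeightedFields.weight I ≤ r)
    (hBind : LinearIndependent ℝ
      (fun I : B => WeightedFields.bracket X (I : List (Fin (n + 1))) xbar))
    (hBspan : Submodule.span ℝ
      (Set.range fun I : B => WeightedFields.bracket X (I : List (Fin (n + 1))) xbar) = ⊤)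
    -- the canonical coordinates `u = (u_I)_{I ∈ B}` near `xbar`
    (e : OpenPartialHomeomorph (Fin p → ℝ) (B → ℝ))
    (he : WeightedFields.IsCanonicalCoordinates Ω X B xbar e)
    -- another system of smooth vector fields near `u = 0`, with the Euler identity
    (V : Set (B → ℝ)) (hV : IsOpen V) (h0V : (0 : B → ℝ) ∈ V)
    (Y : Fin (n + 1) → (B → ℝ) → (B → ℝ))
    (hY : ∀ i, ContDiffOn ℝ ∞ (Y i) V)
    (hEuler : ∀ u ∈ V, ∑ I : B, u I • (Pi.single I (1 : ℝ) : B → ℝ) =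
      ∑ I : B, u I • WeightedFields.bracket Y (I : List (Fin (n + 1))) u) :
    ∀ I : List (Fin (n + 1)), I ≠ [] →
      WeightedFields.FieldWeightGE
        (fun u => VectorField.pullback ℝ e.symm (WeightedFields.bracket X I) u
          - WeightedFields.bracket Y I u)
        (1 - (WeightedFields.weight I : ℤ)) := by
  classical
  have hB' : ∀ I ∈ B, I ≠ [] := fun I hI => (hB I hI).1
  -- A ball, being star-shaped about `0`, keeps the rays used in the Euler identity inside
  -- `e.target`.
  obtain ⟨ε, hε, hεsub⟩ := Metric.isOpen_iff.1 (e.open_target.inter hV) 0 ⟨he.zero_mem, h0V⟩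
  set U : Set (B → ℝ) := Metric.ball 0 ε
  have hU : IsOpen U := Metric.isOpen_ball
  have h0 : (0 : B → ℝ) ∈ U := Metric.mem_ball_self hε
  have hUt : U ⊆ e.target := fun u hu => (hεsub hu).1
  have hUV : U ⊆ V := fun u hu => (hεsub hu).2
  have hray : ∀ u ∈ U, ∀ τ ∈ Set.Icc (0 : ℝ) 1, τ • u ∈ e.target := fun u hu τ hτ =>
    hUt ((convex_ball (0 : B → ℝ) ε).smul_mem_of_zero_mem h0 hu hτ)
  let XX : Fin (n + 1) → (B → ℝ) → (B → ℝ) := fun i => VectorField.pullback ℝ e.symm (X i)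
  have hXX : ∀ i, ContDiffOn ℝ ∞ (XX i) U := fun i => (he.contDiffOn_pullback (hX i)).mono hUt
  have hYU : ∀ i, ContDiffOn ℝ ∞ (Y i) U := fun i => (hY i).mono hUV
  have hXXeq : ∀ I, Set.EqOn (bracket XX I) (VectorField.pullback ℝ e.symm (bracket X I)) U :=
    fun I u hu => he.bracket_pullback hΩ hX I (hUt hu)
  let w : B → ℕ := fun I => weight (I : List (Fin (n + 1)))
  have hw : ∀ I, w I ≤ r := fun I => (hB I I.2).2
  -- The constants are chosen in the free algebra, before any fields enter, so that the same `a`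
  -- serves both frames. Beyond weight `r` they are set to `0` and nothing is claimed.
  have hstruct : ∀ I J : B, ∃ b : B → ℝ, (∀ L, b L ≠ 0 → w L = w I + w J) ∧
      (w I + w J ≤ r → freeBracket (I : List (Fin (n + 1))) * freeBracket J
        - freeBracket J * freeBracket I = ∑ L : B, b L • freeBracket (L : List _)) := by
    intro I J
    by_cases hIJ : w I + w J ≤ r
    · obtain ⟨b, hb, hb'⟩ := exists_eq_sum_of_mem_span hfree hB hBspan hIJ
        (commutator_mem_span (hB' I I.2) (hB' J J.2))
      exact ⟨b, hb, fun _ => hb'⟩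
    · exact ⟨0, by simp, fun h => absurd h hIJ⟩
  choose a ha ha' using hstruct
  have hF : IsEulerFrame w r U a fun I => bracket XX I :=
    { smooth := fun I => contDiffOn_bracket hU hXX I
      euler := fun u hu => by
        simp only [fun I => hXXeq I hu]
        exact he.euler hΩ hX (hray u hu)
      lieBracket_eq := fun I J hIJ u hu => lieBracket_bracket_eq_sum hU hXX hB'
        (hB' I I.2) (hB' J J.2) (ha' I J hIJ) hu }
  have hG : IsEulerFrame w r U a fun I => bracket Y I :=
    { smooth := fun I => contDiffOn_bracket hU hYU I
      euler := fun u hu => by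
        rw [← hEuler u (hUV hu)]
        ext K
        simp [Pi.single_apply]
      lieBracket_eq := fun I J hIJ u hu => lieBracket_bracket_eq_sum hU hYU hB'
        (hB' I I.2) (hB' J J.2) (ha' I J hIJ) hu }
  intro K hK I
  have hsX := contDiffOn_pi.1 (contDiffOn_bracket hU hXX K) I
  have hsY := contDiffOn_pi.1 (contDiffOn_bracket hU hYU K) I
  have heq : Set.EqOn (fun u => bracket XX K u I - bracket Y K u I)
      (fun u => (VectorField.pullback ℝ e.symm (bracket X K) u - bracket Y K u) I) U :=
    fun u hu => by simp [hXXeq K hu]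
  have hs : ContDiffOn ℝ ∞
      (fun u => (VectorField.pullback ℝ e.symm (bracket X K) u - bracket Y K u) I) U :=
    (hsX.sub hsY).congr heq.symm
  refine ⟨hs.contDiffAt (hU.mem_nhds h0), fun k J hJ => ?_⟩
  refine WeightGEUpTo.iteratedFDeriv_eq_zero (w := w) hU h0 hs
    (WeightGEUpTo.congr hU h0 heq ?_) J hJ
  by_cases hKr : weight K ≤ r
  · obtain ⟨b, hb, hb'⟩ := exists_freeBracket_eq_sum hfree hB hBspan hK hKr
    refine WeightGEUpTo.congr hU h0
      (f := fun u => ∑ L : B, b L * (bracket XX L u I - bracket Y L u I)) (fun u hu => ?_) ?_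
    · simp [bracket_eq_sum hU hXX hB' hK hb' hu, bracket_eq_sum hU hYU hB' hK hb' hu, mul_sub]
    · have hsL : ∀ L : B, ContDiffOn ℝ ∞ (fun u => bracket XX L u I - bracket Y L u I) U :=
        fun L => (hF.contDiffOn_apply L I).sub (hG.contDiffOn_apply L I)
      refine WeightGEUpTo.sum hU h0 _ (fun L _ => contDiffOn_const.mul (hsL L)) fun L _ => ?_
      by_cases hL : b L = 0
      · simpa [hL] using weightGEUpTo_const fun _ => rfl
      · refine ((hF.weight_sub hU h0 hw ha hG k L I).const_mul hU h0 (hsL L) _).mono ?_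
        have := hb L hL
        simp only [w]
        omega
  -- `w I ≤ r < weight K`, so the required weight `1 - weight K + w I` is at most `0`.
  · refine weightGEUpTo_of_nonpos _ ?_
    have := hw I
    simp only [w] at this
    omega
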